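/- Let $N\ge 1$ be an integer, let $0<\beta<1/(N+1)$, and let $\Gamma\subset\mathbb R$ be the attractor of $\{\phi_i(x)=\beta x+i(1-\beta)/N : i=0,1,\dots,N\}$, i.e. the unique non-empty compact set with $\Gamma=\bigcup_{i=0}^N\phi_i(\Gamma)$. Let $m\ge 1$ and let $\boldsymbol t=(t_0,\dots,t_m)\in\mathbb R^{m+1}$ with $0=t_0<t_1<\cdots<t_m$. Put $\Gamma_{\boldsymbol t}=\bigcup_{j=0}^m(\Gamma+t_j)$, and let the conjugate $\widehat{\boldsymbol t}$ of $\boldsymbol t$ be given by $\widehat t_j=t_m-t_{m-j}$ for $0\le j\le m$. A non-empty compact set $K\subset\mathbb R$ is self-similar if $K=\bigcup_{f\in\mathcal F}f(K)$ for some finite set $\mathcal F$ of maps of the form $f(x)=\lambda x+a$ with $\lambda,a\in\mathbb R$ and $0<|\lambda|<1$. Let $\Omega=\{0,1,\dots,N\}$. For a word $\mathbf i=i_1\cdots i_n\in\Omega^n$ put $\phi_{\mathbf i}=\phi_{i_1}\circ\cdots\circ\phi_{i_n}$. For $n\ge 1$ let $E_n=\{\phi_{\mathbf i}(0):\mathbf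 i\in\Omega^n\}$ and $T_n=\beta^{-n}E_n$, and let $T=\bigcup_{n\ge 1}T_n$; the sets $T_n$ increase with $n$. For a vector $\boldsymbol s=(s_0,\dots,s_m)\in T^{m+1}$ with $0=s_0<s_1<\cdots<s_m$, let $\tau_{\boldsymbol s}$ be the smallest integer $n\ge 1$ such that $s_1,\dots,s_m\in T_n$, and for $n\ge\tau_{\boldsymbol s}$ put $$\Omega_{\boldsymbol s}^n=\{\mathbf i\in\Omega^n:\phi_{\mathbf i}(s_j)\in E_n\text{ for all }1\le j\le m\},\qquad \widehat\Omega_{\boldsymbol s}^n=\{\mathbf i\in\Omega^n:\phi_{\mathbf i}(-s_j)\in E_n\text{ for all }1\le j\le m\}.$$ A vector $\boldsymbol s\in\mathbb R^{m+1}$ with $0=s_0<s_1<\cdots<s_m$ is called an admissible translation vector if $\boldsymbol s\in T^{m+1}$ and there are finite sets $\mathcal I_1\subset\bigcup_{n\ge\tau_{\boldsymbol s}}\Omega_{\boldsymbol s}^n$ and $\mathcal I_2\subset\bigcup_{n\ge\tau_{\boldsymbol s}}\widehat\Omega_{\boldsymbol s}^n$ (one of which may be empty) such that $$\bigcup_{\mathbf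 i\in\mathcal I_1}\phi_{\mathbf i}(\Gamma_{\boldsymbol s})\ \cup\bigcup_{\mathbf i\in\mathcal I_2}\phi_{\mathbf i}(1-\Gamma_{\boldsymbol s})=\Gamma .$$ Then $\Gamma_{\boldsymbol t}$ is a self-similar set if and only if $\boldsymbol t$ or $\widehat{\boldsymbol t}$ is an admissible translation vector. -/

import Mathlib

namespace CantorUnion

/-- A contractive similitude of the real line: `x ↦ r x + a` with `0 < |r| < 1`. -/
def IsContractiveSimilitude (f : ℝ → ℝ) : Prop :=
  ∃ r a : ℝ, 0 < |r| ∧ |r| < 1 ∧ ∀ x, f x = r * x + a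

/-- A self-similar iterated function system: a finite set of contractive similitudes. -/
def IsSelfSimilarIFS (F : Set (ℝ → ℝ)) : Prop :=
  F.Finite ∧ ∀ f ∈ F, IsContractiveSimilitude f

/-- `K` is the attractor of `F`: a non-empty compact set with `K = ⋃_{f ∈ F} f(K)`. -/
def IsAttractor (F : Set (ℝ → ℝ)) (K : Set ℝ) : Prop :=
  K.Nonempty ∧ IsCompact K ∧ K = ⋃ f ∈ F, f '' K

/-- A self-similar set: the attractor of some self-similar IFS. -/
def IsSelfSimilar (K : Set ℝ) : Prop :=
  ∃ F : Set (ℝ → ℝ), IsSelfSimilarIFS F ∧ IsAttractor F K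

/-- The map `φ_i(x) = β x + i (1 - β) / N`, for `i ∈ {0, …, N}`. -/
noncomputable def phi (N : ℕ) (β : ℝ) (i : Fin (N + 1)) (x : ℝ) : ℝ :=
  β * x + ((i : ℕ) : ℝ) * ((1 - β) / (N : ℝ))

/-- The IFS `{φ_0, …, φ_N}`. -/
def baseIFS (N : ℕ) (β : ℝ) : Set (ℝ → ℝ) :=
  Set.range (phi N β)

/-- `φ_w = φ_{i_1} ∘ ⋯ ∘ φ_{i_n}` for a word `w = i_1 … i_n`.
The set `Ω^n` is the set of lists of length `n` over `Fin (N + 1)`. -/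
noncomputable def phiWord (N : ℕ) (β : ℝ) : List (Fin (N + 1)) → ℝ → ℝ
  | [] => id
  | i :: w => phi N β i ∘ phiWord N β w

/-- `E_n = {φ_w(0) : w ∈ Ω^n}`. -/
def endpts (N : ℕ) (β : ℝ) (n : ℕ) : Set ℝ :=
  {x | ∃ w : List (Fin (N + 1)), w.length = n ∧ phiWord N β w 0 = x}

/-- `T_n = β^{-n} E_n`. -/
def scaledEndpts (N : ℕ) (β : ℝ) (n : ℕ) : Set ℝ :=
  (fun x => (β ^ n)⁻¹ * x) '' endpts N β n

/-- `T = ⋃_{n ≥ 1} T_n`. -/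
def allScaledEndpts (N : ℕ) (β : ℝ) : Set ℝ :=
  ⋃ n ≥ 1, scaledEndpts N β n

/-- A translation vector `t = (t_0, …, t_m)` with `0 = t_0 < t_1 < ⋯ < t_m`. -/
def IsTranslationVector {m : ℕ} (t : Fin (m + 1) → ℝ) : Prop :=
  t 0 = 0 ∧ StrictMono t

/-- `Γ_t = ⋃_{j=0}^m (Γ + t_j)`. -/
def unionTranslates {m : ℕ} (Γ : Set ℝ) (t : Fin (m + 1) → ℝ) : Set ℝ :=
  ⋃ j, (fun x => x + t j) '' Γ

/-- The conjugate vector, `t̂_j = t_m - t_{m-j}`. -/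
def conjugate {m : ℕ} (t : Fin (m + 1) → ℝ) : Fin (m + 1) → ℝ :=
  fun j => t (Fin.last m) - t (Fin.rev j)

/-- `τ_t`, the smallest integer `n ≥ 1` with `t_1, …, t_m ∈ T_n`. Such an `n` exists when all `t_j`
lie in `T`, because `T_n` increases with `n`; only this case is used. -/
noncomputable def tau (N : ℕ) (β : ℝ) {m : ℕ} (t : Fin (m + 1) → ℝ) : ℕ :=
  sInf {n : ℕ | 1 ≤ n ∧ ∀ j : Fin m, t j.succ ∈ scaledEndpts N β n}

/-- `Ω_t^n = {w ∈ Ω^n : φ_w(t_j) ∈ E_n for all 1 ≤ j ≤ m}`. -/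
def wordsPos (N : ℕ) (β : ℝ) {m : ℕ} (t : Fin (m + 1) → ℝ) (n : ℕ) :
    Set (List (Fin (N + 1))) :=
  {w | w.length = n ∧ ∀ j : Fin m, phiWord N β w (t j.succ) ∈ endpts N β n}

/-- `Ω̂_t^n = {w ∈ Ω^n : φ_w(-t_j) ∈ E_n for all 1 ≤ j ≤ m}`. -/
def wordsNeg (N : ℕ) (β : ℝ) {m : ℕ} (t : Fin (m + 1) → ℝ) (n : ℕ) :
    Set (List (Fin (N + 1))) :=
  {w | w.length = n ∧ ∀ j : Fin m, phiWord N β w (-(t j.succ)) ∈ endpts N β n}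

/-- Admissible translation vectors; `Γ` stands for the attractor of `baseIFS N β`. -/
def IsAdmissible (N : ℕ) (β : ℝ) (Γ : Set ℝ) {m : ℕ} (t : Fin (m + 1) → ℝ) : Prop :=
  IsTranslationVector t ∧
  (∀ j, t j ∈ allScaledEndpts N β) ∧
  ∃ I₁ I₂ : Set (List (Fin (N + 1))),
    I₁.Finite ∧ I₂.Finite ∧
    I₁ ⊆ (⋃ n ≥ tau N β t, wordsPos N β t n) ∧
    I₂ ⊆ (⋃ n ≥ tau N β t, wordsNeg N β t n) ∧
    (⋃ w ∈ I₁, phiWord N β w '' unionTranslates Γ t) ∪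
      (⋃ w ∈ I₂, phiWord N β w '' ((fun x => 1 - x) '' unionTranslates Γ t)) = Γ

/-- Any attractor of `baseIFS N β` is contained in any other one. -/
theorem IsAttractor.subset {N : ℕ} {β : ℝ} (h0 : 0 < β) (h1 : β < 1) {K L : Set ℝ}
    (hK : IsAttractor (baseIFS N β) K) (hL : IsAttractor (baseIFS N β) L) : K ⊆ L := by
  obtain ⟨-, hKc, hKe⟩ := hK
  obtain ⟨⟨l, hl⟩, hLc, hLe⟩ := hL
  obtain ⟨D, hD⟩ := hKc.isBounded.subset_closedBall l
  have key : ∀ n : ℕ, ∀ x ∈ K, ∃ y ∈ L, dist x y ≤ β ^ n * D := by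
    intro n
    induction n with
    | zero => intro x hx; exact ⟨l, hl, by simpa using hD hx⟩
    | succ n ih =>
      intro x hx
      rw [hKe] at hx
      simp only [Set.mem_iUnion] at hx
      obtain ⟨f, hf, x', hx', rfl⟩ := hx
      obtain ⟨y, hy, hxy⟩ := ih x' hx'
      refine ⟨f y, ?_, ?_⟩
      · rw [hLe]
        simp only [Set.mem_iUnion]
        exact ⟨f, hf, y, hy, rfl⟩
      · obtain ⟨i, rfl⟩ := hf
        rw [Real.dist_eq] at hxy ⊢
        have : phi N β i x' - phi N β i y = β * (x' - y) := by unfold phi; ring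
        rw [this, abs_mul, abs_of_pos h0, pow_succ']
        nlinarith
  intro x hx
  rw [← hLc.isClosed.closure_eq, Metric.mem_closure_iff]
  intro ε hε
  have ht : Filter.Tendsto (fun n : ℕ => β ^ n * D) Filter.atTop (nhds 0) := by
    simpa using (tendsto_pow_atTop_nhds_zero_of_lt_one h0.le h1).mul_const D
  obtain ⟨n, hn⟩ := (ht.eventually (gt_mem_nhds hε)).exists
  obtain ⟨y, hy, hxy⟩ := key n x hx
  exact ⟨y, hy, lt_of_le_of_lt hxy hn⟩

/-- The IFS `{φ_0, …, φ_N}` has exactly one attractor. -/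
theorem existsUnique_attractor (N : ℕ) {β : ℝ} (h0 : 0 < β) (h1 : β < 1) :
    ∃! K : Set ℝ, IsAttractor (baseIFS N β) K := by
  set c : ℝ := (1 - β) / (N : ℝ) with hc
  let g : (ℕ → Fin (N + 1)) → ℝ := fun d => ∑' k, (((d k : ℕ) : ℝ) * c) * β ^ k
  have hle : ∀ (d : ℕ → Fin (N + 1)) (k : ℕ),
      ‖(((d k : ℕ) : ℝ) * c) * β ^ k‖ ≤ ((N : ℝ) * |c|) * β ^ k := by
    intro d k
    have hd : ((d k : ℕ) : ℝ) ≤ (N : ℝ) := by exact_mod_cast Nat.lt_succ_iff.mp (d k).2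
    rw [norm_mul, norm_mul, Real.norm_eq_abs, Real.norm_eq_abs, Real.norm_eq_abs,
      abs_of_nonneg (Nat.cast_nonneg (α := ℝ) (d k : ℕ)), abs_of_pos (pow_pos h0 k)]
    gcongr
  have hsum : Summable (fun k : ℕ => ((N : ℝ) * |c|) * β ^ k) :=
    (summable_geometric_of_lt_one h0.le h1).mul_left _
  have hs : ∀ d : ℕ → Fin (N + 1), Summable (fun k => (((d k : ℕ) : ℝ) * c) * β ^ k) :=
    fun d => Summable.of_norm_bounded hsum (hle d)
  have hcont : Continuous g := by
    refine continuous_tsum (fun k => ?_) hsum (fun k d => hle d k)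
    have : Continuous (fun i : Fin (N + 1) => ((i : ℕ) : ℝ)) := continuous_of_discreteTopology
    exact ((this.comp (continuous_apply k)).mul continuous_const).mul continuous_const
  have hstep : ∀ d : ℕ → Fin (N + 1), g d = phi N β (d 0) (g (fun k => d (k + 1))) := by
    intro d
    show (∑' k, (((d k : ℕ) : ℝ) * c) * β ^ k) = _
    rw [(hs d).tsum_eq_zero_add]
    unfold phi
    rw [← tsum_mul_left, pow_zero, mul_one, add_comm, ← hc]
    congr 1
    refine tsum_congr (fun k => ?_)
    rw [pow_succ]; ring
  have hA : IsAttractor (baseIFS N β) (Set.range g) := by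
    refine ⟨Set.range_nonempty g, isCompact_range hcont, ?_⟩
    ext x
    simp only [Set.mem_iUnion]
    constructor
    · rintro ⟨d, rfl⟩
      exact ⟨phi N β (d 0), ⟨d 0, rfl⟩, _, ⟨fun k => d (k + 1), rfl⟩, (hstep d).symm⟩
    · rintro ⟨_, ⟨i, rfl⟩, _, ⟨d, rfl⟩, rfl⟩
      refine ⟨fun k => Nat.casesOn k i d, ?_⟩
      rw [hstep]
      rfl
  exact ⟨_, hA, fun L hL => (hL.subset h0 h1 hA).antisymm (hA.subset h0 h1 hL)⟩

end CantorUnion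

/-! Put `c = (1 - β) / N`; the hypothesis on `β` says `β < c`, so the first-level pieces of `Γ` are
separated by gaps of length `c - β`, the largest gaps of `Γ`. A copy of `Γ` scaled by `r < 1` has
only smaller gaps, so it cannot straddle a first-level gap. Peeling off pieces shows that every
orientation preserving similitude of `Γ` into itself is some `φ_w`; reversing ones reduce to these
by the symmetry `x ↦ 1 - x`. If `Γ_t` is self-similar, then `Γ_t` or its reflection is mapped into
itself by some `x ↦ μ x` with `0 < μ < 1` (`exists_mul_maps_or`). A high power of this map sends the
set into `Γ`, and rigidity gives `t_j ∈ T`. Near `0` the set coincides with some `β ^ (n + 1) Γ`.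
Covering the set by tiny copies of itself, keeping those that meet this piece and rescaling covers
`Γ` by images of `Γ_t`, which rigidity turns into words (`isAdmissible_of_mul_maps`). Conversely,
substituting an admissible cover of `Γ` into each `Γ + t_j` gives an IFS for `Γ_t`. -/

namespace CantorUnion

/-! ### Words and scaled endpoints -/

section Words

variable {N : ℕ} {β : ℝ}

theorem phiWord_apply (w : List (Fin (N + 1))) (x : ℝ) :
    phiWord N β w x = β ^ w.length * x + phiWord N β w 0 := by
  induction w generalizing x with
  | nil => simp [phiWord]
  | cons i w ih =>
    simp only [phiWord, Function.comp_apply, List.length_cons]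
    rw [ih x]
    unfold phi
    ring

theorem scaledEndpts_subset_succ (hβ : 0 < β) (n : ℕ) :
    scaledEndpts N β n ⊆ scaledEndpts N β (n + 1) := by
  rintro _ ⟨_, ⟨w, rfl, rfl⟩, rfl⟩
  refine ⟨_, ⟨0 :: w, by simp, rfl⟩, ?_⟩
  have : β ≠ 0 := hβ.ne'
  simp only [phiWord, Function.comp_apply, phi, Fin.val_zero, Nat.cast_zero, zero_mul, add_zero]
  field_simp
  ring

theorem scaledEndpts_mono (hβ : 0 < β) : Monotone (scaledEndpts N β) :=
  monotone_nat_of_le_succ (scaledEndpts_subset_succ hβ)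

/-- This excludes the empty word from admissible covers, so that all their maps contract. Membership
in `T` is needed because `sInf ∅ = 0`. -/
theorem one_le_tau (hβ : 0 < β) {m : ℕ} {t : Fin (m + 1) → ℝ}
    (h : ∀ j, t j ∈ allScaledEndpts N β) : 1 ≤ tau N β t := by
  simp only [allScaledEndpts, Set.mem_iUnion] at h
  choose n hn1 hn using h
  have hne : {n : ℕ | 1 ≤ n ∧ ∀ j : Fin m, t j.succ ∈ scaledEndpts N β n}.Nonempty := by
    refine ⟨Finset.univ.sup n, (hn1 0).trans (Finset.le_sup (Finset.mem_univ _)), fun j => ?_⟩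
    exact scaledEndpts_mono hβ (Finset.le_sup (f := n) (Finset.mem_univ _)) (hn j.succ)
  exact (Nat.sInf_mem hne).1

end Words

/-! ### Symmetry, gaps and rigidity of `Γ` -/

section Attractor

variable {N : ℕ} {β : ℝ} {Γ : Set ℝ}

theorem IsAttractor.mem_iff (hΓ : IsAttractor (baseIFS N β) Γ) (x : ℝ) :
    x ∈ Γ ↔ ∃ i, ∃ y ∈ Γ, phi N β i y = x := by
  conv_lhs => rw [hΓ.2.2]
  simp [baseIFS]

theorem IsAttractor.zero_mem_and_nonneg (h0 : 0 < β) (h1 : β < 1)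
    (hΓ : IsAttractor (baseIFS N β) Γ) : 0 ∈ Γ ∧ ∀ x ∈ Γ, 0 ≤ x := by
  obtain ⟨a, haΓ, ha⟩ := hΓ.2.1.exists_isLeast hΓ.1
  have hle : 0 ≤ a := by
    obtain ⟨i, y, hy, hya⟩ := (hΓ.mem_iff a).1 haΓ
    have : 0 ≤ ((i : ℕ) : ℝ) * ((1 - β) / (N : ℝ)) :=
      mul_nonneg (Nat.cast_nonneg _) (div_nonneg (by linarith) (Nat.cast_nonneg _))
    unfold phi at hya
    nlinarith [ha hy]
  have hge : a ≤ 0 := by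
    have : phi N β 0 a ∈ Γ := (hΓ.mem_iff _).2 ⟨0, a, haΓ, rfl⟩
    have := ha this
    simp only [phi, Fin.val_zero, Nat.cast_zero, zero_mul, add_zero] at this
    nlinarith
  obtain rfl : a = 0 := le_antisymm hge hle
  exact ⟨haΓ, fun x hx => ha hx⟩

theorem phi_rev (hN : 1 ≤ N) (i : Fin (N + 1)) (x : ℝ) :
    phi N β (Fin.rev i) (1 - x) = 1 - phi N β i x := by
  have hN' : (N : ℝ) ≠ 0 := by positivity
  have hi : (i : ℕ) ≤ N := Nat.lt_succ_iff.1 i.2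
  have : ((Fin.rev i : Fin (N + 1)) : ℕ) = N - (i : ℕ) := by rw [Fin.val_rev]; omega
  unfold phi
  rw [this, Nat.cast_sub hi]
  field_simp
  ring

/-- Conjugation by `x ↦ 1 - x` permutes the `φ_i`, so `1 - Γ` is also an attractor, and attractors
are unique. -/
theorem IsAttractor.one_sub_mem (hN : 1 ≤ N) (h0 : 0 < β) (h1 : β < 1)
    (hΓ : IsAttractor (baseIFS N β) Γ) {x : ℝ} (hx : x ∈ Γ) : 1 - x ∈ Γ := by
  have hR : IsAttractor (baseIFS N β) ((fun x => 1 - x) '' Γ) := by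
    refine ⟨hΓ.1.image _, hΓ.2.1.image (by fun_prop), ?_⟩
    ext z
    simp only [baseIFS, Set.mem_iUnion, Set.mem_image, Set.mem_range, exists_prop,
      exists_exists_eq_and, exists_exists_and_eq_and]
    constructor
    · rintro ⟨y, hy, rfl⟩
      obtain ⟨i, x, hx, rfl⟩ := (hΓ.mem_iff y).1 hy
      exact ⟨Fin.rev i, x, hx, phi_rev hN i x⟩
    · rintro ⟨i, x, hx, rfl⟩
      refine ⟨phi N β (Fin.rev i) x, (hΓ.mem_iff _).2 ⟨_, x, hx, rfl⟩, ?_⟩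
      rw [← phi_rev hN, Fin.rev_rev]
  obtain ⟨y, hy, rfl⟩ := hΓ.subset h0 h1 hR hx
  simpa using hy

theorem IsAttractor.one_mem (hN : 1 ≤ N) (h0 : 0 < β) (h1 : β < 1)
    (hΓ : IsAttractor (baseIFS N β) Γ) : 1 ∈ Γ := by
  simpa using hΓ.one_sub_mem hN h0 h1 (hΓ.zero_mem_and_nonneg h0 h1).1

theorem IsAttractor.le_one (hN : 1 ≤ N) (h0 : 0 < β) (h1 : β < 1)
    (hΓ : IsAttractor (baseIFS N β) Γ) {x : ℝ} (hx : x ∈ Γ) : x ≤ 1 := by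
  linarith [(hΓ.zero_mem_and_nonneg h0 h1).2 _ (hΓ.one_sub_mem hN h0 h1 hx)]

/-- Two points of `Γ` further apart than the largest gap `(1 - β) / N - β` are separated by a third
point of `Γ`. -/
theorem IsAttractor.exists_mem_between (hN : 1 ≤ N) (h0 : 0 < β) (h1 : β < 1)
    (hΓ : IsAttractor (baseIFS N β) Γ) (hgap : β < (1 - β) / (N : ℝ)) {x y : ℝ} (hx : x ∈ Γ)
    (hy : y ∈ Γ) (hxy : (1 - β) / (N : ℝ) - β < y - x) : ∃ z ∈ Γ, x < z ∧ z < y := by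
  obtain ⟨z0, hnn⟩ := hΓ.zero_mem_and_nonneg h0 h1
  have hone := hΓ.one_mem hN h0 h1
  have key : ∀ n : ℕ, ∀ x ∈ Γ, ∀ y ∈ Γ, (1 - β) / (N : ℝ) - β < y - x → β ^ n < y - x →
      ∃ z ∈ Γ, x < z ∧ z < y := by
    intro n
    induction n with
    | zero =>
      intro x hx y hy _ h
      rw [pow_zero] at h
      linarith [hnn x hx, hΓ.le_one hN h0 h1 hy]
    | succ n ih =>
      intro x hx y hy hxy hn
      obtain ⟨i, x', hx', hix⟩ := (hΓ.mem_iff x).1 hx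
      obtain ⟨j, y', hy', hjy⟩ := (hΓ.mem_iff y).1 hy
      have hx0 := hnn x' hx'
      have hx1 := hΓ.le_one hN h0 h1 hx'
      have hy0 := hnn y' hy'
      have hy1 := hΓ.le_one hN h0 h1 hy'
      have mem : ∀ (k : Fin (N + 1)), ∀ u ∈ Γ, phi N β k u ∈ Γ :=
        fun k u hu => (hΓ.mem_iff _).2 ⟨k, u, hu, rfl⟩
      set c := (1 - β) / (N : ℝ) with hc
      simp only [phi, ← hc] at hix hjy mem
      rcases lt_trichotomy i j with hij | rfl | hij
      · have hij' : ((i : ℕ) : ℝ) + 1 ≤ ((j : ℕ) : ℝ) := by exact_mod_cast hij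
        -- Try the right end of piece `i`, then the left end of piece `j`. If `x` and `y` are these
        -- ends, adjacent pieces would give `y - x = c - β`, so piece `i + 1` lies strictly between.
        rcases hx1.lt_or_eq with hlt | rfl
        · refine ⟨_, mem i 1 hone, ?_, ?_⟩ <;> nlinarith
        rcases hy0.lt_or_eq with hlt | rfl
        · refine ⟨_, mem j 0 z0, ?_, ?_⟩ <;> nlinarith
        have hne : (i : ℕ) + 1 ≠ (j : ℕ) := by
          intro h
          have : ((i : ℕ) : ℝ) + 1 = ((j : ℕ) : ℝ) := by exact_mod_cast h
          rw [← this] at hjy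
          linarith
        have hlt : (i : ℕ) + 1 < (j : ℕ) := lt_of_le_of_ne hij hne
        have hlt' : ((i : ℕ) : ℝ) + 1 + 1 ≤ ((j : ℕ) : ℝ) := by exact_mod_cast hlt
        have := mem ⟨(i : ℕ) + 1, hlt.trans j.2⟩ 0 z0
        push_cast at this
        refine ⟨_, this, ?_, ?_⟩ <;> nlinarith
      · have hd : y - x = β * (y' - x') := by rw [← hix, ← hjy]; ring
        have hpos : 0 < y' - x' := by
          by_contra hcon
          nlinarith
        obtain ⟨z, hz, hxz, hzy⟩ := ih x' hx' y' hy' (by nlinarith)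
          (by rw [hd, pow_succ', mul_lt_mul_iff_right₀ h0] at hn; exact hn)
        refine ⟨_, mem i z hz, ?_, ?_⟩ <;> nlinarith
      · have hij' : ((j : ℕ) : ℝ) + 1 ≤ ((i : ℕ) : ℝ) := by exact_mod_cast hij
        exfalso
        nlinarith
  obtain ⟨n, hn⟩ := exists_pow_lt_of_lt_one (show 0 < y - x by linarith) h1
  exact key n x hx y hy hxy hn

/-- A similar copy of `Γ` in `Γ` that is smaller than `Γ` lies in one of the first-level pieces. -/
theorem IsAttractor.exists_phi_of_maps (hN : 1 ≤ N) (h0 : 0 < β) (h1 : β < 1)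
    (hΓ : IsAttractor (baseIFS N β) Γ) (hgap : β < (1 - β) / (N : ℝ)) {r a : ℝ} (hr : 0 < r)
    (hr1 : r < 1) (h : ∀ x ∈ Γ, r * x + a ∈ Γ) :
    ∃ i, ∀ x ∈ Γ, ∃ y ∈ Γ, phi N β i y = r * x + a := by
  obtain ⟨z0, hnn⟩ := hΓ.zero_mem_and_nonneg h0 h1
  obtain ⟨i, y₀, hy₀, hiy⟩ := (hΓ.mem_iff _).1 (h 0 z0)
  refine ⟨i, fun x hx => ?_⟩
  set c := (1 - β) / (N : ℝ) with hc
  have hc0 : 0 < c := h0.trans hgap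
  simp only [phi, ← hc] at hiy ⊢
  -- Piece `i` contains the image of `0`, the leftmost image point, so every image lies in piece `i`
  -- or beyond the gap to its right.
  have split : ∀ u ∈ Γ, (∃ y ∈ Γ, β * y + ((i : ℕ) : ℝ) * c = r * u + a) ∨
      (((i : ℕ) : ℝ) + 1) * c ≤ r * u + a := by
    intro u hu
    obtain ⟨j, y, hy, hjy⟩ := (hΓ.mem_iff _).1 (h u hu)
    simp only [phi, ← hc] at hjy
    rcases lt_trichotomy i j with hij | rfl | hij
    · have hij' : ((i : ℕ) : ℝ) + 1 ≤ ((j : ℕ) : ℝ) := by exact_mod_cast hij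
      right
      nlinarith [hnn y hy]
    · exact Or.inl ⟨y, hy, hjy⟩
    · exfalso
      have hij' : ((j : ℕ) : ℝ) + 1 ≤ ((i : ℕ) : ℝ) := by exact_mod_cast hij
      nlinarith [hnn y₀ hy₀, hΓ.le_one hN h0 h1 hy, hnn u hu]
  refine (split x hx).resolve_right fun hxB => ?_
  -- Take the last point `s` sent left of the gap and the first point `e` sent right of it. Since `r
  -- < 1`, `e - s` exceeds `c - β`, so `Γ` has a point between them, whose image has nowhere to go.
  have hA : IsCompact (Γ ∩ {u | r * u + a ≤ ((i : ℕ) : ℝ) * c + β}) :=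
    hΓ.2.1.inter_right (isClosed_le (by fun_prop) (by fun_prop))
  have hB : IsCompact (Γ ∩ {u | (((i : ℕ) : ℝ) + 1) * c ≤ r * u + a}) :=
    hΓ.2.1.inter_right (isClosed_le (by fun_prop) (by fun_prop))
  obtain ⟨s, ⟨hs, hs'⟩, hsmax⟩ := hA.exists_isGreatest ⟨0, z0, by
    simp only [Set.mem_ofPred_eq, ← hiy]
    nlinarith [hΓ.le_one hN h0 h1 hy₀]⟩
  obtain ⟨e, ⟨he, he'⟩, hemin⟩ := hB.exists_isLeast ⟨x, hx, hxB⟩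
  simp only [Set.mem_ofPred_eq] at hs' he'
  have hes : c - β ≤ r * (e - s) := by linarith
  have hpos : 0 < e - s := by
    by_contra hcon
    nlinarith
  obtain ⟨z, hz, hsz, hze⟩ := hΓ.exists_mem_between hN h0 h1 hgap hs he (by nlinarith)
  rcases split z hz with ⟨y, hy, hyz⟩ | hzB
  · refine hsz.not_ge (hsmax ⟨hz, ?_⟩)
    simp only [Set.mem_ofPred_eq, ← hyz]
    nlinarith [hΓ.le_one hN h0 h1 hy]
  · exact hze.not_ge (hemin ⟨hz, hzB⟩)

/-- Every orientation preserving similitude mapping `Γ` into itself is one of the `φ_w`. -/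
theorem IsAttractor.exists_phiWord_of_maps (hN : 1 ≤ N) (h0 : 0 < β) (h1 : β < 1)
    (hΓ : IsAttractor (baseIFS N β) Γ) (hgap : β < (1 - β) / (N : ℝ)) {r a : ℝ} (hr : 0 < r)
    (h : ∀ x ∈ Γ, r * x + a ∈ Γ) : ∃ w, ∀ x, phiWord N β w x = r * x + a := by
  obtain ⟨z0, hnn⟩ := hΓ.zero_mem_and_nonneg h0 h1
  have hone := hΓ.one_mem hN h0 h1
  -- Removing one `φ_i` divides the ratio by `β`, while the ratio stays at most `1`; hence the
  -- peeling stops.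
  have key : ∀ n : ℕ, ∀ r a : ℝ, 0 < r → β ^ n < r → (∀ x ∈ Γ, r * x + a ∈ Γ) →
      ∃ w, ∀ x, phiWord N β w x = r * x + a := by
    intro n
    induction n with
    | zero =>
      intro r a _ hr h
      have ha := hnn _ (h 0 z0)
      have hra := hΓ.le_one hN h0 h1 (h 1 hone)
      rw [pow_zero] at hr
      linarith
    | succ n ih =>
      intro r a hr hn h
      have ha := hnn _ (h 0 z0)
      have hra := hΓ.le_one hN h0 h1 (h 1 hone)
      rcases (show r ≤ 1 by linarith).lt_or_eq with hr1 | rfl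
      · obtain ⟨i, hi⟩ := hΓ.exists_phi_of_maps hN h0 h1 hgap hr hr1 h
        obtain ⟨w, hw⟩ := ih (r / β) ((a - ((i : ℕ) : ℝ) * ((1 - β) / (N : ℝ))) / β)
          (div_pos hr h0) (by rwa [lt_div_iff₀ h0, ← pow_succ]) (by
            intro x hx
            obtain ⟨y, hy, hyx⟩ := hi x hx
            have hyx' : y = r / β * x + (a - ((i : ℕ) : ℝ) * ((1 - β) / (N : ℝ))) / β := by
              rw [div_mul_eq_mul_div, ← add_div, eq_div_iff h0.ne']
              unfold phi at hyx
              linarith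
            exact hyx' ▸ hy)
        refine ⟨i :: w, fun x => ?_⟩
        simp only [phiWord, Function.comp_apply, hw, phi]
        field_simp
        ring
      · exact ⟨[], fun x => by simp only [phiWord, id]; linarith⟩
  obtain ⟨n, hn⟩ := exists_pow_lt_of_lt_one hr h1
  exact key n r a hr hn h

/-- The part of `Γ` to the left of `β ^ n (1 - β) / N` is `β ^ (n + 1) Γ`. -/
theorem IsAttractor.exists_eq_pow_mul (h0 : 0 < β) (h1 : β < 1)
    (hΓ : IsAttractor (baseIFS N β) Γ) (hgap : β < (1 - β) / (N : ℝ)) (n : ℕ) {x : ℝ}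
    (hx : x ∈ Γ) (hxn : x < β ^ n * ((1 - β) / (N : ℝ))) : ∃ y ∈ Γ, x = β ^ (n + 1) * y := by
  have hnn := (hΓ.zero_mem_and_nonneg h0 h1).2
  have hc0 : 0 < (1 - β) / (N : ℝ) := h0.trans hgap
  have first : ∀ x ∈ Γ, x < (1 - β) / (N : ℝ) → ∃ y ∈ Γ, x = β * y := by
    intro x hx hxc
    obtain ⟨i, y, hy, rfl⟩ := (hΓ.mem_iff x).1 hx
    refine ⟨y, hy, ?_⟩
    rcases Nat.eq_zero_or_pos (i : ℕ) with hi | hi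
    · simp [phi, hi]
    · have : (1 : ℝ) ≤ ((i : ℕ) : ℝ) := by exact_mod_cast hi
      unfold phi at hxc
      nlinarith [hnn y hy]
  induction n generalizing x with
  | zero => simpa using first x hx (by simpa using hxn)
  | succ n ih =>
    obtain ⟨y, hy, rfl⟩ := first x hx
      (hxn.trans_le (mul_le_of_le_one_left hc0.le (pow_le_one₀ h0.le h1.le)))
    obtain ⟨z, hz, rfl⟩ := ih hy (by
      rwa [pow_succ', mul_assoc, mul_lt_mul_iff_right₀ h0] at hxn)
    exact ⟨z, hz, by ring⟩

end Attractor

/-! ### Self-similar sets: small covers and reflection -/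

section SelfSimilar

/-- A self-similar set is a finite union of arbitrarily small similar copies of itself. -/
theorem IsSelfSimilar.exists_small_cover {K : Set ℝ} (hK : IsSelfSimilar K) {ε : ℝ} (hε : 0 < ε) :
    ∃ P : Set (ℝ × ℝ), P.Finite ∧ (∀ p ∈ P, 0 < |p.1| ∧ |p.1| < ε) ∧
      ∀ x, x ∈ K ↔ ∃ p ∈ P, ∃ y ∈ K, p.1 * y + p.2 = x := by
  obtain ⟨F, ⟨hF, hsim⟩, -, -, hKF⟩ := hK
  have mem : ∀ x, x ∈ K ↔ ∃ f ∈ F, ∃ y ∈ K, f y = x := by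
    intro x
    conv_lhs => rw [hKF]
    simp
  unfold IsContractiveSimilitude at hsim
  choose! r a hr0 hr1 hra using hsim
  obtain ⟨ρ, hρ0, hρ1, hρ⟩ : ∃ ρ : ℝ, 0 < ρ ∧ ρ < 1 ∧ ∀ f ∈ F, |r f| ≤ ρ := by
    rcases F.eq_empty_or_nonempty with rfl | hne
    · exact ⟨1 / 2, by norm_num, by norm_num, by simp⟩
    · obtain ⟨g, hg, hmax⟩ := Set.exists_max_image F (fun f => |r f|) hF hne
      exact ⟨|r g|, hr0 g hg, hr1 g hg, hmax⟩
  have key : ∀ n : ℕ, ∃ P : Set (ℝ × ℝ), P.Finite ∧ (∀ p ∈ P, 0 < |p.1| ∧ |p.1| ≤ ρ ^ n) ∧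
      ∀ x, x ∈ K ↔ ∃ p ∈ P, ∃ y ∈ K, p.1 * y + p.2 = x := by
    intro n
    induction n with
    | zero => exact ⟨{(1, 0)}, Set.finite_singleton _, by simp, by simp⟩
    | succ n ih =>
      obtain ⟨P, hP, hPr, hPK⟩ := ih
      refine ⟨Set.image2 (fun p f => (p.1 * r f, p.1 * a f + p.2)) P F, hP.image2 _ hF, ?_, ?_⟩
      · rintro _ ⟨p, hp, f, hf, rfl⟩
        simp only [abs_mul, pow_succ]
        exact ⟨mul_pos (hPr p hp).1 (hr0 f hf),
          mul_le_mul (hPr p hp).2 (hρ f hf) (abs_nonneg _) (by positivity)⟩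
      · intro x
        rw [hPK]
        constructor
        · rintro ⟨p, hp, y, hy, rfl⟩
          obtain ⟨f, hf, z, hz, rfl⟩ := (mem y).1 hy
          refine ⟨_, ⟨p, hp, f, hf, rfl⟩, z, hz, ?_⟩
          rw [hra f hf]
          ring
        · rintro ⟨_, ⟨p, hp, f, hf, rfl⟩, z, hz, rfl⟩
          refine ⟨p, hp, f z, (mem _).2 ⟨f, hf, z, hz, rfl⟩, ?_⟩
          rw [hra f hf]
          ring
  obtain ⟨n, hn⟩ := exists_pow_lt_of_lt_one hε hρ1
  obtain ⟨P, hP, hPr, hPK⟩ := key n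
  exact ⟨P, hP, fun p hp => ⟨(hPr p hp).1, (hPr p hp).2.trans_lt hn⟩, hPK⟩

theorem isSelfSimilar_of_finite_cover {K : Set ℝ} (hne : K.Nonempty) (hc : IsCompact K)
    {P : Set (ℝ × ℝ)} (hP : P.Finite) (hPr : ∀ p ∈ P, 0 < |p.1| ∧ |p.1| < 1)
    (hPK : ∀ x, x ∈ K ↔ ∃ p ∈ P, ∃ y ∈ K, p.1 * y + p.2 = x) : IsSelfSimilar K := by
  refine ⟨(fun (p : ℝ × ℝ) (x : ℝ) => p.1 * x + p.2) '' P, ⟨hP.image _, ?_⟩, hne, hc, ?_⟩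
  · rintro _ ⟨p, hp, rfl⟩
    exact ⟨p.1, p.2, (hPr p hp).1, (hPr p hp).2, fun x => rfl⟩
  · ext x
    rw [hPK x]
    simp

theorem IsSelfSimilar.reflect {K : Set ℝ} (hK : IsSelfSimilar K) (M : ℝ) :
    IsSelfSimilar ((fun x => M - x) '' K) := by
  obtain ⟨P, hP, hPr, hPK⟩ := hK.exists_small_cover one_pos
  obtain ⟨F, -, hne, hc, -⟩ := hK
  refine isSelfSimilar_of_finite_cover (P := (fun p => (p.1, M - p.1 * M - p.2)) '' P)
    (hne.image _) (hc.image (by fun_prop)) (hP.image _) ?_ ?_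
  · rintro _ ⟨p, hp, rfl⟩
    exact hPr p hp
  · intro x
    constructor
    · rintro ⟨z, hz, rfl⟩
      obtain ⟨p, hp, y, hy, rfl⟩ := (hPK z).1 hz
      exact ⟨_, ⟨p, hp, rfl⟩, _, ⟨y, hy, rfl⟩, by ring⟩
    · rintro ⟨_, ⟨p, hp, rfl⟩, _, ⟨y, hy, rfl⟩, rfl⟩
      exact ⟨p.1 * y + p.2, (hPK _).2 ⟨p, hp, y, hy, rfl⟩, by ring⟩

end SelfSimilar

/-! ### Unions of translates and admissibility -/

section Translates

variable {N : ℕ} {β : ℝ} {Γ : Set ℝ} {m : ℕ} {t : Fin (m + 1) → ℝ}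

theorem mem_unionTranslates {x : ℝ} :
    x ∈ unionTranslates Γ t ↔ ∃ j, ∃ y ∈ Γ, y + t j = x := by
  simp only [unionTranslates, Set.mem_iUnion, Set.mem_image]

theorem IsTranslationVector.conjugate (ht : IsTranslationVector t) :
    IsTranslationVector (conjugate t) := by
  refine ⟨by simp [CantorUnion.conjugate], fun i j hij => ?_⟩
  simp only [CantorUnion.conjugate]
  have := ht.2 (Fin.rev_lt_rev.2 hij)
  linarith

theorem IsTranslationVector.conjugate_conjugate (ht : IsTranslationVector t) :
    CantorUnion.conjugate (CantorUnion.conjugate t) = t := by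
  funext j
  simp [CantorUnion.conjugate, ht.1]

theorem mem_unionTranslates_conjugate (hsymm : ∀ x ∈ Γ, 1 - x ∈ Γ) {x : ℝ} :
    x ∈ unionTranslates Γ (conjugate t) ↔ 1 + t (Fin.last m) - x ∈ unionTranslates Γ t := by
  simp only [mem_unionTranslates, conjugate]
  constructor
  · rintro ⟨j, y, hy, rfl⟩
    exact ⟨Fin.rev j, 1 - y, hsymm y hy, by ring⟩
  · rintro ⟨j, y, hy, h⟩
    exact ⟨Fin.rev j, 1 - y, hsymm y hy, by rw [Fin.rev_rev]; linarith⟩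

theorem unionTranslates_conjugate (hsymm : ∀ x ∈ Γ, 1 - x ∈ Γ) :
    unionTranslates Γ (conjugate t) =
      (fun x => 1 + t (Fin.last m) - x) '' unionTranslates Γ t := by
  ext x
  rw [mem_unionTranslates_conjugate hsymm]
  exact ⟨fun h => ⟨_, h, by ring⟩, by rintro ⟨y, hy, rfl⟩; simpa using hy⟩

theorem unionTranslates_bounds (hN : 1 ≤ N) (h0 : 0 < β) (h1 : β < 1)
    (hΓ : IsAttractor (baseIFS N β) Γ) (ht : IsTranslationVector t) {x : ℝ}
    (hx : x ∈ unionTranslates Γ t) : 0 ≤ x ∧ x ≤ 1 + t (Fin.last m) := by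
  obtain ⟨j, y, hy, rfl⟩ := mem_unionTranslates.1 hx
  have h1' := hΓ.le_one hN h0 h1 hy
  have h0' := (hΓ.zero_mem_and_nonneg h0 h1).2 y hy
  have hj0 := ht.2.monotone (Fin.zero_le j)
  have hjl := ht.2.monotone (Fin.le_last j)
  rw [ht.1] at hj0
  constructor <;> linarith

theorem IsAdmissible.isSelfSimilar (h0 : 0 < β) (h1 : β < 1) (hne : Γ.Nonempty)
    (hc : IsCompact Γ) (h : IsAdmissible N β Γ t) : IsSelfSimilar (unionTranslates Γ t) := by
  obtain ⟨-, hT, I₁, I₂, hI₁, hI₂, hs₁, hs₂, hcov⟩ := h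
  have htau := one_le_tau h0 hT
  have len₁ : ∀ w ∈ I₁, w.length ≠ 0 := by
    intro w hw
    have := hs₁ hw
    simp only [Set.mem_iUnion, wordsPos, Set.mem_ofPred_eq] at this
    obtain ⟨n, hn, hwn, -⟩ := this
    omega
  have len₂ : ∀ w ∈ I₂, w.length ≠ 0 := by
    intro w hw
    have := hs₂ hw
    simp only [Set.mem_iUnion, wordsNeg, Set.mem_ofPred_eq] at this
    obtain ⟨n, hn, hwn, -⟩ := this
    omega
  have hmem : ∀ x, x ∈ Γ ↔ (∃ w ∈ I₁, ∃ y ∈ unionTranslates Γ t, phiWord N β w y = x) ∨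
      (∃ w ∈ I₂, ∃ y ∈ unionTranslates Γ t, phiWord N β w (1 - y) = x) := by
    intro x
    conv_lhs => rw [← hcov]
    simp
  have hpow : ∀ n : ℕ, n ≠ 0 → 0 < |β ^ n| ∧ |β ^ n| < 1 := by
    intro n hn
    rw [abs_of_pos (pow_pos h0 n)]
    exact ⟨pow_pos h0 n, pow_lt_one₀ h0.le h1 hn⟩
  refine isSelfSimilar_of_finite_cover
    -- These are the maps `y ↦ φ_w(y) + t_j` and `y ↦ φ_w(1 - y) + t_j`.
    (P := Set.image2 (fun w j => (β ^ w.length, phiWord N β w 0 + t j)) I₁ Set.univ ∪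
      Set.image2 (fun w j => (-β ^ w.length, phiWord N β w 1 + t j)) I₂ Set.univ)
    ?_ ?_ ((hI₁.image2 _ Set.finite_univ).union (hI₂.image2 _ Set.finite_univ)) ?_ ?_
  · obtain ⟨x, hx⟩ := hne
    exact ⟨_, mem_unionTranslates.2 ⟨0, x, hx, rfl⟩⟩
  · exact isCompact_iUnion fun j => hc.image (by fun_prop)
  · rintro _ (⟨w, hw, j, -, rfl⟩ | ⟨w, hw, j, -, rfl⟩)
    · exact hpow _ (len₁ w hw)
    · simpa only [abs_neg] using hpow _ (len₂ w hw)
  · intro x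
    constructor
    · intro hx
      obtain ⟨j, z, hz, rfl⟩ := mem_unionTranslates.1 hx
      rcases (hmem z).1 hz with ⟨w, hw, y, hy, rfl⟩ | ⟨w, hw, y, hy, rfl⟩
      · refine ⟨_, Or.inl ⟨w, hw, j, trivial, rfl⟩, y, hy, ?_⟩
        rw [phiWord_apply w y]
        ring
      · refine ⟨_, Or.inr ⟨w, hw, j, trivial, rfl⟩, y, hy, ?_⟩
        simp only [phiWord_apply w (1 - y), phiWord_apply w 1]
        ring
    · rintro ⟨_, ⟨w, hw, j, -, rfl⟩ | ⟨w, hw, j, -, rfl⟩, y, hy, rfl⟩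
      · refine mem_unionTranslates.2 ⟨j, _, (hmem _).2 (Or.inl ⟨w, hw, y, hy, rfl⟩), ?_⟩
        rw [phiWord_apply w y]
        ring
      · refine mem_unionTranslates.2 ⟨j, _, (hmem _).2 (Or.inr ⟨w, hw, y, hy, rfl⟩), ?_⟩
        simp only [phiWord_apply w (1 - y), phiWord_apply w 1]
        ring

/-- One of the two extreme points of a self-similar `Γ_t` is fixed by an orientation preserving
contraction of `Γ_t`. -/
theorem exists_mul_maps_or (hN : 1 ≤ N) (h0 : 0 < β) (h1 : β < 1)
    (hΓ : IsAttractor (baseIFS N β) Γ) (ht : IsTranslationVector t)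
    (hK : IsSelfSimilar (unionTranslates Γ t)) :
    (∃ μ : ℝ, 0 < μ ∧ μ < 1 ∧ ∀ x ∈ unionTranslates Γ t, μ * x ∈ unionTranslates Γ t) ∨
      ∃ μ : ℝ, 0 < μ ∧ μ < 1 ∧
        ∀ x ∈ unionTranslates Γ (conjugate t), μ * x ∈ unionTranslates Γ (conjugate t) := by
  obtain ⟨P, -, hPr, hPK⟩ := hK.exists_small_cover one_pos
  have hsymm : ∀ x ∈ Γ, 1 - x ∈ Γ := fun x hx => hΓ.one_sub_mem hN h0 h1 hx
  set M := 1 + t (Fin.last m) with hM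
  have hb : ∀ x ∈ unionTranslates Γ t, 0 ≤ x ∧ x ≤ M :=
    fun x hx => unionTranslates_bounds hN h0 h1 hΓ ht hx
  have hz : (0 : ℝ) ∈ unionTranslates Γ t :=
    mem_unionTranslates.2 ⟨0, 0, (hΓ.zero_mem_and_nonneg h0 h1).1, by rw [ht.1, add_zero]⟩
  have hMm : M ∈ unionTranslates Γ t :=
    mem_unionTranslates.2 ⟨Fin.last m, 1, hΓ.one_mem hN h0 h1, hM.symm⟩
  have maps : ∀ p ∈ P, ∀ x ∈ unionTranslates Γ t, p.1 * x + p.2 ∈ unionTranslates Γ t :=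
    fun p hp x hx => (hPK _).2 ⟨p, hp, x, hx, rfl⟩
  obtain ⟨p, hp, y, hy, hpy⟩ := (hPK 0).1 hz
  obtain ⟨q, hq, z, hz', hqz⟩ := (hPK M).1 hMm
  rcases lt_or_gt_of_ne (abs_pos.1 (hPr p hp).1) with hp0 | hp0
  · have hpM : p.1 * M + p.2 = 0 := by
      nlinarith [hb _ (maps p hp M hMm), hb y hy]
    rcases lt_or_gt_of_ne (abs_pos.1 (hPr q hq).1) with hq0 | hq0
    -- Both maps swap the ends, `M ↦ 0` and `0 ↦ M`, so their composite preserves orientation and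
    -- fixes `0`.
    · have hqM : q.2 = M := by nlinarith [hb _ (maps q hq 0 hz), hb z hz']
      refine Or.inl ⟨p.1 * q.1, mul_pos_of_neg_of_neg hp0 hq0, ?_, fun x hx => ?_⟩
      · have h1 := (hPr p hp).2
        have h2 := (hPr q hq).2
        rw [abs_of_neg hp0] at h1
        rw [abs_of_neg hq0] at h2
        nlinarith
      · convert maps p hp _ (maps q hq x hx) using 1
        rw [hqM]
        linear_combination -hpM
    · have hqM : q.1 * M + q.2 = M := by nlinarith [hb _ (maps q hq M hMm), hb z hz']
      refine Or.inr ⟨q.1, hq0, by simpa [abs_of_pos hq0] using (hPr q hq).2, fun x hx => ?_⟩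
      rw [mem_unionTranslates_conjugate hsymm, ← hM] at hx ⊢
      convert maps q hq _ hx using 1
      linear_combination -hqM
  · have hp2 : p.2 = 0 := by nlinarith [hb _ (maps p hp 0 hz), hb y hy]
    refine Or.inl ⟨p.1, hp0, by simpa [abs_of_pos hp0] using (hPr p hp).2, fun x hx => ?_⟩
    simpa [hp2] using maps p hp x hx

/-- If a similitude maps `Γ_t` into `Γ`, it is `φ_w` or `x ↦ φ_w (1 - x)` for a word `w` compatible
with `t`. -/
theorem exists_word_of_maps (hN : 1 ≤ N) (h0 : 0 < β) (h1 : β < 1)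
    (hΓ : IsAttractor (baseIFS N β) Γ) (hgap : β < (1 - β) / (N : ℝ)) (ht : IsTranslationVector t)
    {r a : ℝ} (hr : r ≠ 0) (h : ∀ x ∈ unionTranslates Γ t, r * x + a ∈ Γ) :
    ∃ w : List (Fin (N + 1)), |r| = β ^ w.length ∧
      ((0 < r ∧ (∀ x, phiWord N β w x = r * x + a) ∧
          ∀ j, phiWord N β w (t j) ∈ endpts N β w.length) ∨
        ((∀ x, phiWord N β w (1 - x) = r * x + a) ∧
          ∀ j, phiWord N β w (-(t j)) ∈ endpts N β w.length)) := by
  have ratio : ∀ {w : List (Fin (N + 1))} {s b : ℝ}, (∀ x, phiWord N β w x = s * x + b) →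
      s = β ^ w.length := by
    intro w s b hw
    have h1 := hw 1
    have h0 := hw 0
    rw [phiWord_apply] at h1
    linarith
  have inj : ∀ {k l : ℕ}, β ^ k = β ^ l → k = l :=
    fun hkl => pow_right_injective₀ h0 h1.ne hkl
  rcases lt_or_gt_of_ne hr with hr | hr
  · have hw : ∀ j, ∃ w, ∀ x, phiWord N β w x = -r * x + (r * (1 + t j) + a) := by
      intro j
      refine hΓ.exists_phiWord_of_maps hN h0 h1 hgap (neg_pos.2 hr) fun x hx => ?_
      convert h _ (mem_unionTranslates.2 ⟨j, 1 - x, hΓ.one_sub_mem hN h0 h1 hx, rfl⟩) using 1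
      ring
    choose w hw using hw
    refine ⟨w 0, by rw [abs_of_neg hr, ratio (hw 0)], Or.inr ⟨fun x => ?_, fun j => ?_⟩⟩
    · rw [hw 0, ht.1]
      ring
    -- The words `w j` have equal ratios, hence equal lengths, and `φ_{w j}(0) = φ_{w 0}(-t_j)`.
    · refine ⟨w j, inj ((ratio (hw j)).symm.trans (ratio (hw 0))), ?_⟩
      rw [hw j, hw 0, ht.1]
      ring
  · have hw : ∀ j, ∃ w, ∀ x, phiWord N β w x = r * x + (r * t j + a) := by
      intro j
      refine hΓ.exists_phiWord_of_maps hN h0 h1 hgap hr fun x hx => ?_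
      convert h _ (mem_unionTranslates.2 ⟨j, x, hx, rfl⟩) using 1
      ring
    choose w hw using hw
    refine ⟨w 0, by rw [abs_of_pos hr, ratio (hw 0)], Or.inl ⟨hr, fun x => ?_, fun j => ?_⟩⟩
    · rw [hw 0, ht.1]
      ring
    · refine ⟨w j, inj ((ratio (hw j)).symm.trans (ratio (hw 0))), ?_⟩
      rw [hw j, hw 0, ht.1]
      ring

theorem mem_of_mem_unionTranslates_of_lt (hnn : ∀ x ∈ Γ, 0 ≤ x) (ht : IsTranslationVector t)
    {δ : ℝ} (hδ : ∀ j, j ≠ 0 → δ ≤ t j) {x : ℝ} (hx : x ∈ unionTranslates Γ t) (hxδ : x < δ) :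
    x ∈ Γ := by
  obtain ⟨j, y, hy, rfl⟩ := mem_unionTranslates.1 hx
  by_cases hj : j = 0
  · subst hj
    rwa [ht.1, add_zero]
  · linarith [hδ j hj, hnn y hy]

theorem IsTranslationVector.exists_pos_le (ht : IsTranslationVector t) :
    ∃ δ : ℝ, 0 < δ ∧ ∀ j, j ≠ 0 → δ ≤ t j := by
  have hpos : ∀ j, j ≠ 0 → 0 < t j := fun j hj => by
    rw [← ht.1]
    exact ht.2 (Fin.pos_iff_ne_zero.2 hj)
  rcases Set.eq_empty_or_nonempty {j : Fin (m + 1) | j ≠ 0} with he | hne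
  · exact ⟨1, one_pos, fun j hj => absurd (show j ∈ {j : Fin (m + 1) | j ≠ 0} from hj) (by simp [he])⟩
  · obtain ⟨k, hk, hmin⟩ := Set.exists_min_image _ t (Set.toFinite {j : Fin (m + 1) | j ≠ 0}) hne
    exact ⟨t k, hpos k hk, hmin⟩

theorem mem_allScaledEndpts_of_mul_maps (hN : 1 ≤ N) (h0 : 0 < β) (h1 : β < 1)
    (hΓ : IsAttractor (baseIFS N β) Γ) (hgap : β < (1 - β) / (N : ℝ)) (ht : IsTranslationVector t)
    {μ : ℝ} (hμ0 : 0 < μ) (hμ1 : μ < 1)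
    (hμ : ∀ x ∈ unionTranslates Γ t, μ * x ∈ unionTranslates Γ t) (j : Fin (m + 1)) :
    t j ∈ allScaledEndpts N β := by
  obtain ⟨δ, hδ0, hδ⟩ := ht.exists_pos_le
  set M := 1 + t (Fin.last m) with hM
  have hM0 : 0 < M := by
    have := ht.2.monotone (Fin.zero_le (Fin.last m))
    rw [ht.1] at this
    linarith
  obtain ⟨k, hk⟩ := exists_pow_lt_of_lt_one (div_pos hδ0 hM0) hμ1
  rw [lt_div_iff₀ hM0] at hk
  -- The exponent is `k + 1` because `k` may be `0`; a ratio below `1` makes the word non-empty, as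
  -- `T` requires.
  have hk' : μ ^ (k + 1) < 1 := pow_lt_one₀ hμ0.le hμ1 (by omega)
  have hiter : ∀ n : ℕ, ∀ x ∈ unionTranslates Γ t, μ ^ n * x ∈ unionTranslates Γ t := by
    intro n
    induction n with
    | zero => intro x hx; simpa using hx
    | succ n ih =>
      intro x hx
      rw [pow_succ, mul_assoc]
      exact ih _ (hμ x hx)
  have hmaps : ∀ x ∈ unionTranslates Γ t, μ ^ (k + 1) * x + 0 ∈ Γ := by
    intro x hx
    rw [add_zero]
    refine mem_of_mem_unionTranslates_of_lt (hΓ.zero_mem_and_nonneg h0 h1).2 ht hδ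
      (hiter _ x hx) (lt_of_le_of_lt ?_ hk)
    obtain ⟨hx0, hx1⟩ := unionTranslates_bounds hN h0 h1 hΓ ht hx
    exact mul_le_mul (pow_le_pow_of_le_one hμ0.le hμ1.le (Nat.le_succ k)) hx1 hx0 (by positivity)
  have hpos : 0 < μ ^ (k + 1) := pow_pos hμ0 _
  obtain ⟨w, hw, hw'⟩ := exists_word_of_maps hN h0 h1 hΓ hgap ht hpos.ne' hmaps
  rw [abs_of_pos hpos] at hw
  have hlen : 1 ≤ w.length := by
    rcases Nat.eq_zero_or_pos w.length with h | h
    · rw [h, pow_zero] at hw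
      linarith
    · exact h
  rcases hw' with ⟨-, hx, hj⟩ | ⟨hx, -⟩
  · simp only [allScaledEndpts, Set.mem_iUnion]
    refine ⟨w.length, hlen, _, hj j, ?_⟩
    simp only [hx, add_zero, hw]
    field_simp
  -- In this case the ratio would be `-β ^ w.length`, but it is positive.
  · have e0 := hx 0
    have e1 := hx 1
    rw [phiWord_apply] at e0
    simp only [sub_self, sub_zero] at e0 e1
    have : 0 < β ^ w.length := pow_pos h0 _
    linarith

theorem exists_finite_choice {α β : Type*} {S : Set α} (hS : S.Finite)
    (R : α → β → Prop) : ∃ I : Set β, I.Finite ∧ (∀ b ∈ I, ∃ a ∈ S, R a b) ∧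
      ∀ a ∈ S, (∃ b, R a b) → ∃ b ∈ I, R a b := by
  have : ∀ a : {a | a ∈ S ∧ ∃ b, R a b}, ∃ b, R a b := fun a => a.2.2
  choose f hf using this
  have : Finite {a | a ∈ S ∧ ∃ b, R a b} := (hS.subset fun a ha => ha.1).to_subtype
  refine ⟨Set.range f, Set.finite_range f, ?_, fun a ha hb => ⟨f ⟨a, ha, hb⟩, ⟨_, rfl⟩, hf ⟨a, ha, hb⟩⟩⟩
  rintro _ ⟨a, rfl⟩
  exact ⟨a, a.2.1, hf a⟩

theorem isAdmissible_of_mul_maps (hN : 1 ≤ N) (h0 : 0 < β) (h1 : β < 1)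
    (hΓ : IsAttractor (baseIFS N β) Γ) (hgap : β < (1 - β) / (N : ℝ)) (ht : IsTranslationVector t)
    (hK : IsSelfSimilar (unionTranslates Γ t)) {μ : ℝ} (hμ0 : 0 < μ) (hμ1 : μ < 1)
    (hμ : ∀ x ∈ unionTranslates Γ t, μ * x ∈ unionTranslates Γ t) : IsAdmissible N β Γ t := by
  refine ⟨ht, mem_allScaledEndpts_of_mul_maps hN h0 h1 hΓ hgap ht hμ0 hμ1 hμ, ?_⟩
  obtain ⟨z0, hnn⟩ := hΓ.zero_mem_and_nonneg h0 h1
  obtain ⟨δ, hδ0, hδ⟩ := ht.exists_pos_le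
  set M := 1 + t (Fin.last m) with hM
  have hM0 : 0 < M := by
    have := ht.2.monotone (Fin.zero_le (Fin.last m))
    rw [ht.1] at this
    linarith
  set c := (1 - β) / (N : ℝ) with hc
  have hc0 : 0 < c := h0.trans hgap
  -- Below `δ` only the translate by `t_0 = 0` is present, and the gap after `β ^ (n + 1) Γ` ends at
  -- `β ^ n c < δ`.
  obtain ⟨n, hn⟩ := exists_pow_lt_of_lt_one (div_pos hδ0 hc0) h1
  rw [lt_div_iff₀ hc0] at hn
  have hβn : 0 < β ^ n := pow_pos h0 n
  have hβn1 : 0 < β ^ (n + 1) := pow_pos h0 _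
  have near : ∀ x ∈ unionTranslates Γ t, x < β ^ n * c → ∃ y ∈ Γ, x = β ^ (n + 1) * y :=
    fun x hx hxn => hΓ.exists_eq_pow_mul h0 h1 hgap n
      (mem_of_mem_unionTranslates_of_lt hnn ht hδ hx (hxn.trans hn)) hxn
  have near' : ∀ y ∈ Γ, β ^ (n + 1) * y ∈ unionTranslates Γ t := by
    intro y hy
    have hz : ∀ k : ℕ, β ^ k * y ∈ Γ := by
      intro k
      induction k with
      | zero => simpa using hy
      | succ k ih =>
        exact (hΓ.mem_iff _).2 ⟨0, _, ih, by simp [phi, pow_succ', mul_assoc]⟩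
    exact mem_unionTranslates.2 ⟨0, _, hz _, by rw [ht.1, add_zero]⟩
  -- The first bound makes each copy shorter than the gap after `β ^ (n + 1) Γ`, so a copy meeting
  -- that piece lies in it. The second makes the words obtained after rescaling at least `tau N β t`
  -- long.
  have hε : 0 < min (β ^ n * (c - β) / M) (β ^ (n + 1) * β ^ tau N β t) :=
    lt_min (div_pos (mul_pos hβn (sub_pos.2 hgap)) hM0) (mul_pos hβn1 (pow_pos h0 _))
  obtain ⟨P, hP, hPr, hPK⟩ := hK.exists_small_cover hε
  set Q : Set (ℝ × ℝ) :=
    {p ∈ P | ∃ y ∈ unionTranslates Γ t, ∃ x ∈ Γ, p.1 * y + p.2 = β ^ (n + 1) * x} with hQ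
  have hQfin : Q.Finite := hP.subset fun p hp => hp.1
  have hQmaps : ∀ p ∈ Q, ∀ y ∈ unionTranslates Γ t,
      (p.1 / β ^ (n + 1)) * y + p.2 / β ^ (n + 1) ∈ Γ := by
    rintro p ⟨hp, y₀, hy₀, x₀, hx₀, hyx⟩ y hy
    obtain ⟨x, hx, hyx'⟩ := near (p.1 * y + p.2) ((hPK _).2 ⟨p, hp, y, hy, rfl⟩) (by
      have hpε := (hPr p hp).2.trans_le (min_le_left _ _)
      rw [lt_div_iff₀ hM0] at hpε
      obtain ⟨hy0, hy1⟩ := unionTranslates_bounds hN h0 h1 hΓ ht hy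
      obtain ⟨hz0, hz1⟩ := unionTranslates_bounds hN h0 h1 hΓ ht hy₀
      have hd : |y - y₀| ≤ M := by rw [abs_le]; constructor <;> linarith
      have hle : p.1 * (y - y₀) ≤ |p.1| * M :=
        (le_abs_self _).trans (by rw [abs_mul]; gcongr)
      have hx1 : β ^ (n + 1) * x₀ ≤ β ^ n * β := by
        rw [← pow_succ]
        exact mul_le_of_le_one_right hβn1.le (hΓ.le_one hN h0 h1 hx₀)
      linarith)
    convert hx using 1
    rw [div_mul_eq_mul_div, ← add_div, hyx']
    field_simp
  have hQword := fun p (hp : p ∈ Q) => exists_word_of_maps hN h0 h1 hΓ hgap ht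
    (div_ne_zero (abs_pos.1 (hPr p hp.1).1) hβn1.ne') (hQmaps p hp)
  have hQtau : ∀ p ∈ Q, ∀ k : ℕ, |p.1 / β ^ (n + 1)| = β ^ k → tau N β t ≤ k := by
    intro p hp k hk
    have hpε := (hPr p hp.1).2.trans_le (min_le_right _ _)
    rw [abs_div, abs_of_pos hβn1] at hk
    rw [mul_comm, ← div_lt_iff₀ hβn1, hk] at hpε
    exact ((pow_lt_pow_iff_right_of_lt_one₀ h0 h1).1 hpε).le
  obtain ⟨I₁, hI₁, hI₁Q, hQI₁⟩ := exists_finite_choice hQfin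
    fun p (w : List (Fin (N + 1))) => |p.1 / β ^ (n + 1)| = β ^ w.length ∧
      (∀ x, phiWord N β w x = p.1 / β ^ (n + 1) * x + p.2 / β ^ (n + 1)) ∧
        ∀ j, phiWord N β w (t j) ∈ endpts N β w.length
  obtain ⟨I₂, hI₂, hI₂Q, hQI₂⟩ := exists_finite_choice hQfin
    fun p (w : List (Fin (N + 1))) => |p.1 / β ^ (n + 1)| = β ^ w.length ∧
      (∀ x, phiWord N β w (1 - x) = p.1 / β ^ (n + 1) * x + p.2 / β ^ (n + 1)) ∧
        ∀ j, phiWord N β w (-(t j)) ∈ endpts N β w.length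
  refine ⟨I₁, I₂, hI₁, hI₂, ?_, ?_, ?_⟩
  · intro w hw
    obtain ⟨p, hp, hlen, -, hj⟩ := hI₁Q w hw
    simp only [Set.mem_iUnion]
    exact ⟨w.length, hQtau p hp _ hlen, rfl, fun j => hj j.succ⟩
  · intro w hw
    obtain ⟨p, hp, hlen, -, hj⟩ := hI₂Q w hw
    simp only [Set.mem_iUnion]
    exact ⟨w.length, hQtau p hp _ hlen, rfl, fun j => hj j.succ⟩
  · ext x
    simp only [Set.mem_union, Set.mem_iUnion, Set.mem_image, exists_prop,
      exists_exists_and_eq_and]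
    constructor
    · rintro (⟨w, hw, y, hy, rfl⟩ | ⟨w, hw, y, hy, rfl⟩)
      · obtain ⟨p, hp, -, hx, -⟩ := hI₁Q w hw
        rw [hx]
        exact hQmaps p hp y hy
      · obtain ⟨p, hp, -, hx, -⟩ := hI₂Q w hw
        rw [hx]
        exact hQmaps p hp y hy
    · intro hx
      obtain ⟨p, hp, y, hy, hyx⟩ := (hPK _).1 (near' x hx)
      have hpQ : p ∈ Q := ⟨hp, y, hy, x, hx, hyx⟩
      have hxy : p.1 / β ^ (n + 1) * y + p.2 / β ^ (n + 1) = x := by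
        rw [div_mul_eq_mul_div, ← add_div, hyx]
        field_simp
      obtain ⟨w, hlen, ⟨-, hw⟩ | hw⟩ := hQword p hpQ
      · obtain ⟨v, hv, -, hv', -⟩ := hQI₁ p hpQ ⟨w, hlen, hw⟩
        exact Or.inl ⟨v, hv, y, hy, (hv' y).trans hxy⟩
      · obtain ⟨v, hv, -, hv', -⟩ := hQI₂ p hpQ ⟨w, hlen, hw⟩
        exact Or.inr ⟨v, hv, y, hy, (hv' y).trans hxy⟩

end Translates

end CantorUnion

theorem theorem1p1 (N : ℕ) (hN : 1 ≤ N) (β : ℝ) (hβ0 : 0 < β) (hβ1 : β < 1 / ((N : ℝ) + 1))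
    (Γ : Set ℝ) (hΓ : CantorUnion.IsAttractor (CantorUnion.baseIFS N β) Γ)
    (m : ℕ) (hm : 1 ≤ m) (t : Fin (m + 1) → ℝ) (ht : CantorUnion.IsTranslationVector t) :
    CantorUnion.IsSelfSimilar (CantorUnion.unionTranslates Γ t) ↔
      CantorUnion.IsAdmissible N β Γ t ∨
        CantorUnion.IsAdmissible N β Γ (CantorUnion.conjugate t) := by
  have hN0 : (0 : ℝ) < N := by exact_mod_cast hN
  rw [lt_div_iff₀ (by positivity)] at hβ1
  have h1 : β < 1 := by nlinarith
  -- Equivalent to `β < 1 / (N + 1)`: consecutive first-level pieces are separated.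
  have hgap : β < (1 - β) / (N : ℝ) := by
    rw [lt_div_iff₀ hN0]
    linarith
  have hsymm : ∀ x ∈ Γ, 1 - x ∈ Γ := fun x hx => hΓ.one_sub_mem hN hβ0 h1 hx
  constructor
  · intro hK
    rcases CantorUnion.exists_mul_maps_or hN hβ0 h1 hΓ ht hK with
      ⟨μ, hμ0, hμ1, hμ⟩ | ⟨μ, hμ0, hμ1, hμ⟩
    · exact Or.inl
        (CantorUnion.isAdmissible_of_mul_maps hN hβ0 h1 hΓ hgap ht hK hμ0 hμ1 hμ)
    · refine Or.inr (CantorUnion.isAdmissible_of_mul_maps hN hβ0 h1 hΓ hgap ht.conjugate ?_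
        hμ0 hμ1 hμ)
      rw [CantorUnion.unionTranslates_conjugate hsymm]
      exact hK.reflect _
  · rintro (h | h)
    · exact h.isSelfSimilar hβ0 h1 hΓ.1 hΓ.2.1
    · have hK := h.isSelfSimilar hβ0 h1 hΓ.1 hΓ.2.1
      rw [← ht.conjugate_conjugate, CantorUnion.unionTranslates_conjugate hsymm]
      exact hK.reflect _
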